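/- Let $P=[p_{ij}]$ be the transition matrix of an irreducible Markov chain $\{X_n\}_{n\ge 0}$ on a finite state space $S$, and let $\pi^T=(\pi_i)$ be its stationary probability vector, so $\pi^TP=\pi^T$ and $\sum_i\pi_i=1$. Let $T_{ij}=\min\{n\ge 1: X_n=j\}$, given $X_0=i$, be the first passage time from $i$ to $j$ (first return time if $i=j$), and let $m_{ij}^{(k)}=E[T_{ij}^k\mid X_0=i]$ and $M^{(k)}=[m_{ij}^{(k)}]$. Write $e$ for the all-ones column vector, $I$ for the identity matrix, $\Pi=e\pi^T$, $D=\operatorname{diag}(1/\pi_i)$, and $A_d$ for the diagonal matrix with the same diagonal as $A$. Then every $\pi_i$ is positive, every $m^{(2)}_{ij}$ is finite, $M^{(1)}_d=D$, and the following hold. (a) For every real matrix $G$ with $(I-P)G(I-P)=I-P$ (a g-inverse of $I-P$), $$M_d^{(2)}=D+2D\{(I-\Pi)G(I-\Pi)\}_d\,D.$$ (b) If moreover $Ge=ge$ for some real number $g$, then $$M_d^{(2)}=D+2D\{(I-\Pi)G\}_d\,D.$$ (c) In particular, the matrix $I-P+\Pi$ is invertible; with $Z=(I-P+\Pi)^{-1}$,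 the matrix $Z-\Pi$ is a group inverse of $I-P$; and for every group inverse $A^\#$ of $I-P$ (a matrix with $(I-P)A^\#(I-P)=I-P$, $A^\#(I-P)A^\#=A^\#$ and $(I-P)A^\#=A^\#(I-P)$), $$M_d^{(2)}=D+2DA^\#_d D=2DZ_dD-D.$$ -/

import Mathlib

open Matrix MeasureTheory
open scoped ENNReal

namespace FirstPassage

variable {S Ω : Type*}

/-- `X` is, under the measure `μ`, a Markov chain with transition matrix `P`: given any past
`X 0 = x 0, …, X n = x n`, the next state is `x (n + 1)` with probability `P (x n) (x (n + 1))`.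
The conditional probability is written in product form; the initial distribution is free. -/
structure IsMarkovChain [MeasurableSpace Ω] (P : Matrix S S ℝ) (μ : Measure Ω)
    (X : ℕ → Ω → S) : Prop where
  measurableSet_eq : ∀ n s, MeasurableSet {ω | X n ω = s}
  step : ∀ (n : ℕ) (x : ℕ → S),
    μ {ω | ∀ k ≤ n + 1, X k ω = x k} =
      μ {ω | ∀ k ≤ n, X k ω = x k} * ENNReal.ofReal (P (x n) (x (n + 1)))

/-- The first passage time to `j`: the least `n ≥ 1` with `X n = j`, and `⊤` if there is none. -/
noncomputable def passageTime (X : ℕ → Ω → S) (j : S) (ω : Ω) : ℕ∞ :=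
  ⨅ (n : ℕ) (_ : 1 ≤ n ∧ X n ω = j), (n : ℕ∞)

/-- The `k`-th moment `E[T_{ij} ^ k | X 0 = i]`, as an extended nonnegative real. Here `ℙ i` is
the law under which the chain starts in state `i`. -/
noncomputable def passageMoment [MeasurableSpace Ω] (ℙ : S → Measure Ω) (X : ℕ → Ω → S)
    (k : ℕ) (i j : S) : ℝ≥0∞ :=
  ∫⁻ ω, ((passageTime X j ω : ℕ∞) : ℝ≥0∞) ^ k ∂(ℙ i)

/-- The matrix `M^{(k)}` of `k`-th moments of the first passage times. -/
noncomputable def momentMatrix [MeasurableSpace Ω] (ℙ : S → Measure Ω) (X : ℕ → Ω → S)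
    (k : ℕ) : Matrix S S ℝ :=
  Matrix.of fun i j => (passageMoment ℙ X k i j).toReal

/-- `A_d`: the diagonal matrix with the same diagonal as `A`. -/
def diagPart [DecidableEq S] (A : Matrix S S ℝ) : Matrix S S ℝ :=
  Matrix.diagonal A.diag

/-- `Π = e πᵀ`: every row is `π`. -/
def rowMatrix (π : S → ℝ) : Matrix S S ℝ :=
  Matrix.vecMulVec 1 π

/-- `D`: the diagonal matrix with entries `1 / π i`. -/
noncomputable def recipDiag [DecidableEq S] (π : S → ℝ) : Matrix S S ℝ :=
  Matrix.diagonal fun i => 1 / π i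

/-- `π` is a stationary probability vector of `P`. -/
def IsStationary [Fintype S] (P : Matrix S S ℝ) (π : S → ℝ) : Prop :=
  π ∈ stdSimplex ℝ S ∧ π ᵥ* P = π

/-- `G` is a (one condition) generalized inverse of `A`. -/
def IsGInverse [Fintype S] (A G : Matrix S S ℝ) : Prop :=
  A * G * A = A

/-- `G` is a group inverse of `A`. -/
def IsGroupInverse [Fintype S] (A G : Matrix S S ℝ) : Prop :=
  A * G * A = A ∧ G * A * G = G ∧ A * G = G * A

end FirstPassage

open FirstPassage

namespace FirstPassage

/-! Fix the target `j` and let Q be the taboo matrix. Survival past time n has probability (Qⁿe)ᵢ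
(`measure_lt_passageTime`), so tail sums give E[T] = m = ∑ Qⁿe and E[T² + T] = 2∑(n+1)Qⁿe = 2w with
w = ∑ Qⁿm. By the maximum principle 1 - Q is injective, which makes these series converge; hence m =
e + Qm and w = m + Qw. Since πQ = π - πⱼeⱼᵀ, pairing with π gives πⱼmⱼ = 1 and πⱼwⱼ = π·m, so only
π·m is missing. For v = m - mⱼeⱼ one has (I-P)v = e - mⱼeⱼ. The projected H = (I-Π)G(I-Π) is still a
g-inverse, with He = 0 and πH = 0. Then v - H(I-P)v is harmonic, hence constant; its entry at `j` is
mⱼHⱼⱼ and its π-average is π·m - 1. Equating them proves (a) (`two_mul_sub_eq`). In (b) and (c) one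
or both projections are absorbed by G. -/

/-- The transition matrix `P` with the transitions into `j` removed. -/
def taboo {S : Type*} [DecidableEq S] (P : Matrix S S ℝ) (j : S) : Matrix S S ℝ :=
  P.updateCol j 0

theorem taboo_apply {S : Type*} [DecidableEq S] (P : Matrix S S ℝ) (i j k : S) :
    taboo P j i k = if k = j then 0 else P i k := by
  simp [taboo, Matrix.updateCol_apply]

theorem mulVec_mono {S : Type*} [Fintype S] {A : Matrix S S ℝ}
    (hA : ∀ i k, 0 ≤ A i k) {v w : S → ℝ} (h : v ≤ w) :
    A *ᵥ v ≤ A *ᵥ w := fun i =>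
  Finset.sum_le_sum fun k _ => mul_le_mul_of_nonneg_left (h k) (hA i k)

theorem stationary_dotProduct_one {S : Type*} [Fintype S] {P : Matrix S S ℝ} {π : S → ℝ}
    (hπ : IsStationary P π) : π ⬝ᵥ 1 = 1 := by
  rw [dotProduct_one]
  exact hπ.1.2

/-! ### Potential theory of the taboo matrix. -/

section Matrices

variable {S : Type*} [Fintype S] [DecidableEq S] {P : Matrix S S ℝ}

theorem taboo_nonneg (hP : P ∈ Matrix.rowStochastic ℝ S) (j i k : S) : 0 ≤ taboo P j i k := by
  rw [taboo_apply]
  split_ifs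
  · exact le_rfl
  · exact nonneg_of_mem_rowStochastic hP

theorem taboo_mulVec (P : Matrix S S ℝ) (j : S) (v : S → ℝ) :
    taboo P j *ᵥ v = P *ᵥ v - v j • P *ᵥ Pi.single j 1 := by
  ext i
  have h : ∀ k, taboo P j i k * v k = P i k * v k - if k = j then v j * P i j else 0 := by
    intro k
    rw [taboo_apply]
    split_ifs with hk
    · subst hk; ring
    · ring
  simp [Matrix.mulVec, dotProduct, h, Finset.sum_sub_distrib]

theorem taboo_mulVec_one_le (hP : P ∈ Matrix.rowStochastic ℝ S) (j i : S) :
    (taboo P j *ᵥ 1) i ≤ 1 := by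
  rw [taboo_mulVec, one_vecMul_of_mem_rowStochastic hP]
  have := nonneg_of_mem_rowStochastic hP (i := i) (j := j)
  simpa using this

/-- A set closed under the transitions of an irreducible chain is not avoided by any state. -/
theorem exists_pos_of_closed (hP : P ∈ Matrix.rowStochastic ℝ S) (hirr : P.IsIrreducible)
    {A : Set S} (hA : ∀ i ∈ A, ∀ k, P i k ≠ 0 → k ∈ A) (hne : A.Nonempty) (j : S) :
    ∃ i ∈ A, P i j ≠ 0 := by
  by_contra! h
  have key : ∀ n : ℕ, ∀ i ∈ A, (P ^ (n + 1)) i j = 0 := by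
    intro n
    induction n with
    | zero => intro i hi; simpa using h i hi
    | succ n ih =>
      intro i hi
      rw [pow_succ', Matrix.mul_apply]
      refine Finset.sum_eq_zero fun l _ => ?_
      by_cases hl : P i l = 0
      · rw [hl, zero_mul]
      · rw [ih l (hA i hi l hl), mul_zero]
  obtain ⟨i, hi⟩ := hne
  obtain ⟨k, hk, hpos⟩ := (isIrreducible_iff_exists_pow_pos
    fun _ _ => nonneg_of_mem_rowStochastic hP).1 hirr i j
  obtain ⟨n, rfl⟩ := Nat.exists_eq_succ_of_ne_zero hk.ne'
  exact hpos.ne' (key n i hi)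

/-- The maximum principle for the taboo matrix. -/
theorem eq_zero_of_taboo_mulVec_eq (hP : P ∈ Matrix.rowStochastic ℝ S)
    (hirr : P.IsIrreducible) (j : S) {v : S → ℝ} (hv : taboo P j *ᵥ v = v) : v = 0 := by
  obtain ⟨i₀, -, hmax⟩ := Finset.exists_max_image Finset.univ (fun i => |v i|)
    ⟨j, Finset.mem_univ j⟩
  by_contra hne
  have hc : 0 < |v i₀| := by
    obtain ⟨k, hk⟩ := Function.ne_iff.1 hne
    exact (abs_pos.2 hk).trans_le (hmax k (Finset.mem_univ k))
  have hterm : ∀ i k, P i k * |v i₀| - taboo P j i k * |v k| ≥ 0 := by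
    intro i k
    rw [taboo_apply]
    have hp : 0 ≤ P i k := nonneg_of_mem_rowStochastic hP
    split_ifs
    · simpa using mul_nonneg hp hc.le
    · exact sub_nonneg.2 (mul_le_mul_of_nonneg_left (hmax k (Finset.mem_univ k)) hp)
  -- Where |v| is maximal, the estimate |v i| ≤ ∑ Q|v| ≤ |v i₀| is an equality term by term. So the
  -- maximal set is closed under transitions, and none of them may enter `j`.
  have hzero : ∀ i, |v i| = |v i₀| → ∀ k, P i k * |v i₀| - taboo P j i k * |v k| = 0 := by
    intro i hi
    have hle : ∑ k, (P i k * |v i₀| - taboo P j i k * |v k|) ≤ 0 := by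
      rw [Finset.sum_sub_distrib, ← Finset.sum_mul, sum_row_of_mem_rowStochastic hP, one_mul,
        ← hi, sub_nonpos]
      calc |v i| = |(taboo P j *ᵥ v) i| := by rw [hv]
        _ ≤ ∑ k, |taboo P j i k * v k| := Finset.abs_sum_le_sum_abs _ _
        _ = ∑ k, taboo P j i k * |v k| :=
          Finset.sum_congr rfl fun k _ => by rw [abs_mul, abs_of_nonneg (taboo_nonneg hP j i k)]
    have hs := le_antisymm hle (Finset.sum_nonneg fun k _ => hterm i k)
    intro k
    exact (Finset.sum_eq_zero_iff_of_nonneg fun k _ => hterm i k).1 hs k (Finset.mem_univ k)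
  obtain ⟨i, hi, hij⟩ := exists_pos_of_closed hP hirr (A := {i | |v i| = |v i₀|})
    (fun i hi k hk => by
      have h := hzero i hi k
      rw [taboo_apply] at h
      split_ifs at h
      · simp [hk, hc.ne'] at h
      · rw [← mul_sub] at h
        have := (mul_eq_zero.1 h).resolve_left hk
        exact (sub_eq_zero.1 this).symm) ⟨i₀, rfl⟩ j
  have h := hzero i hi j
  rw [taboo_apply, if_pos rfl, zero_mul, sub_zero] at h
  exact (mul_ne_zero hij hc.ne') h

/-- The harmonic vectors of an irreducible chain are constant. -/
theorem eq_const_of_mulVec_eq (hP : P ∈ Matrix.rowStochastic ℝ S)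
    (hirr : P.IsIrreducible) (j : S) {v : S → ℝ} (hv : P *ᵥ v = v) : v = v j • 1 := by
  -- The shifted vector vanishes at `j`, where the taboo matrix and `P` differ.
  have h : taboo P j *ᵥ (v - v j • 1) = v - v j • 1 := by
    rw [taboo_mulVec, Matrix.mulVec_sub, Matrix.mulVec_smul, hv,
      one_vecMul_of_mem_rowStochastic hP]
    simp
  exact sub_eq_zero.1 (eq_zero_of_taboo_mulVec_eq hP hirr j h)

theorem taboo_pow_mulVec_nonneg (hP : P ∈ Matrix.rowStochastic ℝ S) (j : S) {v : S → ℝ}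
    (hv : 0 ≤ v) (n : ℕ) : 0 ≤ taboo P j ^ n *ᵥ v := by
  induction n with
  | zero => simpa using hv
  | succ n ih =>
    rw [pow_succ', ← Matrix.mulVec_mulVec]
    simpa using mulVec_mono (taboo_nonneg hP j) ih

theorem taboo_pow_mulVec_one_le (hP : P ∈ Matrix.rowStochastic ℝ S) (j : S) (n : ℕ) :
    taboo P j ^ n *ᵥ 1 ≤ 1 := by
  induction n with
  | zero => simp
  | succ n ih =>
    rw [pow_succ', ← Matrix.mulVec_mulVec]
    exact (mulVec_mono (taboo_nonneg hP j) ih).trans fun i => taboo_mulVec_one_le hP j i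

/-- The Neumann series of the taboo matrix converges on nonnegative vectors. -/
theorem summable_taboo_pow_mulVec (hP : P ∈ Matrix.rowStochastic ℝ S)
    (hirr : P.IsIrreducible) (j : S) {v : S → ℝ} (hv : 0 ≤ v) :
    Summable fun n : ℕ => taboo P j ^ n *ᵥ v := by
  have hunit : IsUnit (1 - taboo P j) := by
    rw [← Matrix.mulVec_injective_iff_isUnit, ← Matrix.coe_mulVecLin, ← LinearMap.ker_eq_bot,
      LinearMap.ker_eq_bot']
    intro x hx
    rw [Matrix.mulVecLin_apply, Matrix.sub_mulVec, Matrix.one_mulVec, sub_eq_zero] at hx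
    exact eq_zero_of_taboo_mulVec_eq hP hirr j hx.symm
  -- An algebraic solution of (1 - Q)m = v, of unknown sign, bounds the partial sums: they telescope
  -- to m - Qⁿm, and -m ≤ |c|e with Qⁿe ≤ e.
  obtain ⟨m, hm⟩ := Matrix.mulVec_surjective_iff_isUnit.2 hunit v
  obtain ⟨c, hc⟩ : ∃ c : ℝ, -m ≤ c • 1 := by
    refine ⟨∑ k, |m k|, fun i => ?_⟩
    have h := Finset.single_le_sum (f := fun k => |m k|) (fun k _ => abs_nonneg (m k))
      (Finset.mem_univ i)
    simpa using (neg_le_abs (m i)).trans h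
  have hc0 : 0 ≤ |c| := abs_nonneg c
  rw [Pi.summable]
  intro i
  refine summable_of_sum_range_le (c := m i + |c|)
    (fun n => taboo_pow_mulVec_nonneg hP j hv n i) fun n => ?_
  have hsum : ∑ k ∈ Finset.range n, taboo P j ^ k *ᵥ v = m - taboo P j ^ n *ᵥ m := by
    rw [← hm]
    induction n with
    | zero => simp
    | succ n ih =>
      rw [Finset.sum_range_succ, ih, Matrix.mulVec_mulVec, mul_sub, mul_one, ← pow_succ,
        Matrix.sub_mulVec]
      abel
  have hb : taboo P j ^ n *ᵥ (-m) ≤ |c| • 1 := by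
    have h1 : ∀ k l, 0 ≤ (taboo P j ^ n) k l :=
      fun k l => Matrix.pow_apply_nonneg (taboo_nonneg hP j) n k l
    refine (mulVec_mono h1 (hc.trans ?_ : -m ≤ |c| • 1)).trans ?_
    · intro k; simpa using le_abs_self c
    · rw [Matrix.mulVec_smul]
      exact smul_le_smul_of_nonneg_left (taboo_pow_mulVec_one_le hP j n) hc0
  have h2 := congrFun hsum i
  have h3 := hb i
  simp only [Finset.sum_apply, Pi.sub_apply, Matrix.mulVec_neg, Pi.neg_apply, Pi.smul_apply,
    Pi.one_apply, smul_eq_mul, mul_one] at h2 h3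
  rw [h2]
  linarith

/-- The potential `∑ Q ^ n v` of the taboo matrix `Q`. -/
noncomputable def potential (P : Matrix S S ℝ) (j : S) (v : S → ℝ) : S → ℝ :=
  ∑' n : ℕ, taboo P j ^ n *ᵥ v

theorem potential_nonneg (hP : P ∈ Matrix.rowStochastic ℝ S) (j : S) {v : S → ℝ}
    (hv : 0 ≤ v) : 0 ≤ potential P j v :=
  tsum_nonneg fun n => taboo_pow_mulVec_nonneg hP j hv n

theorem hasSum_taboo_pow_add_mulVec (hP : P ∈ Matrix.rowStochastic ℝ S)
    (hirr : P.IsIrreducible) (j : S) {v : S → ℝ} (hv : 0 ≤ v) (n : ℕ) :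
    HasSum (fun k : ℕ => taboo P j ^ (n + k) *ᵥ v) (taboo P j ^ n *ᵥ potential P j v) := by
  have h := (summable_taboo_pow_mulVec hP hirr j hv).hasSum.map (taboo P j ^ n).mulVecLin
    (LinearMap.continuous_of_finiteDimensional _)
  simpa [Function.comp_def, Matrix.mulVec_mulVec, pow_add, potential] using h

theorem potential_eq (hP : P ∈ Matrix.rowStochastic ℝ S)
    (hirr : P.IsIrreducible) (j : S) {v : S → ℝ} (hv : 0 ≤ v) :
    potential P j v = v + taboo P j *ᵥ potential P j v := by
  have h := hasSum_taboo_pow_add_mulVec hP hirr j hv 1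
  rw [pow_one] at h
  rw [← h.tsum_eq, potential, (summable_taboo_pow_mulVec hP hirr j hv).tsum_eq_zero_add]
  simp [add_comm]

theorem dotProduct_taboo_mulVec {π : S → ℝ} (hπ : π ᵥ* P = π) (j : S) (v : S → ℝ) :
    π ⬝ᵥ taboo P j *ᵥ v = π ⬝ᵥ v - π j * v j := by
  rw [taboo_mulVec, dotProduct_sub, dotProduct_smul, Matrix.dotProduct_mulVec,
    Matrix.dotProduct_mulVec, hπ]
  simp [mul_comm]

/-- Kac's formula, for the solution of the first-step equation. -/
theorem stationary_mul_eq_one {π : S → ℝ} (hπ : IsStationary P π) (j : S) {m : S → ℝ}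
    (hm : m = 1 + taboo P j *ᵥ m) : π j * m j = 1 := by
  have h := congrArg (π ⬝ᵥ ·) hm
  simp only [dotProduct_add, dotProduct_taboo_mulVec hπ.2, stationary_dotProduct_one hπ] at h
  linarith

/-- The diagonal of the iterated potential in terms of a g-inverse annihilating `e` and `π`. -/
theorem two_mul_sub_eq (hP : P ∈ Matrix.rowStochastic ℝ S) (hirr : P.IsIrreducible)
    {π : S → ℝ} (hπ : IsStationary P π) (j : S) {m w : S → ℝ}
    (hm : m = 1 + taboo P j *ᵥ m) (hw : w = m + taboo P j *ᵥ w)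
    {H : Matrix S S ℝ} (hH : IsGInverse (1 - P) H) (hH1 : H *ᵥ 1 = 0) (hπH : π ᵥ* H = 0) :
    2 * w j - m j = 1 / π j + 2 * (1 / π j * H j j * (1 / π j)) := by
  have hk := stationary_mul_eq_one hπ j hm
  have hπj : π j ≠ 0 := left_ne_zero_of_mul_eq_one hk
  have hmj : m j = 1 / π j := by field_simp; linarith
  have hwj : π j * w j = π ⬝ᵥ m := by
    have h := congrArg (π ⬝ᵥ ·) hw
    simp only [dotProduct_add, dotProduct_taboo_mulVec hπ.2] at h
    linarith
  -- Zeroing the entry at `j` gives Qm = Pv, which trades the taboo matrix for `P`.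
  set v : S → ℝ := m - m j • Pi.single j 1 with hv
  have hr : (1 - P) *ᵥ v = 1 - m j • Pi.single j 1 := by
    have h1 : m - P *ᵥ m = 1 - m j • P *ᵥ Pi.single j 1 := by
      rw [taboo_mulVec] at hm
      nth_rewrite 1 [hm]
      abel
    rw [hv, Matrix.mulVec_sub, Matrix.sub_mulVec, Matrix.sub_mulVec, Matrix.one_mulVec,
      Matrix.one_mulVec, h1, Matrix.mulVec_smul]
    abel
  set x : S → ℝ := v - H *ᵥ ((1 - P) *ᵥ v) with hx
  have hx0 : (1 - P) *ᵥ x = 0 := by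
    rw [hx, Matrix.mulVec_sub, Matrix.mulVec_mulVec, Matrix.mulVec_mulVec,
      show (1 - P) * H * (1 - P) = 1 - P from hH, sub_self]
  rw [Matrix.sub_mulVec, Matrix.one_mulVec, sub_eq_zero] at hx0
  have hconst := eq_const_of_mulVec_eq hP hirr j hx0.symm
  have hxj : x j = m j * H j j := by
    rw [hx, hr, Matrix.mulVec_sub, hH1, Matrix.mulVec_smul, hv]
    simp
  have hπx : π ⬝ᵥ x = x j := by
    rw [hconst, dotProduct_smul, stationary_dotProduct_one hπ]
    simp
  have hπv : π ⬝ᵥ x = π ⬝ᵥ m - 1 := by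
    rw [hx, dotProduct_sub, Matrix.dotProduct_mulVec π H, hπH, zero_dotProduct, sub_zero, hv,
      dotProduct_sub, dotProduct_smul, dotProduct_single_one, smul_eq_mul, mul_comm (m j), hk]
  have : w j = m j * (1 + m j * H j j) := by
    have h : π ⬝ᵥ m = 1 + m j * H j j := by linarith
    rw [← h, ← hwj, ← mul_assoc, mul_comm (m j), hk, one_mul]
  rw [this, ← hmj]
  ring

end Matrices

/-! ### Tail-sum identities. -/

section PassageTime

theorem lt_passageTime_iff {S Ω : Type*} (X : ℕ → Ω → S) (j : S) (ω : Ω) (n : ℕ) :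
    (n : ℕ∞) < passageTime X j ω ↔ ∀ m, 1 ≤ m → m ≤ n → X m ω ≠ j := by
  rw [← ENat.add_one_le_iff (ENat.natCast_ne_top n), passageTime, le_iInf₂_iff]
  constructor
  · intro h m h1 hmn hm
    have := h m ⟨h1, hm⟩
    norm_cast at this
    omega
  · rintro h m ⟨h1, hm⟩
    have : n + 1 ≤ m := by
      by_contra hlt
      exact h m h1 (by omega) hm
    exact_mod_cast this

theorem tsum_indicator_lt (t : ℕ∞) : ∑' n : ℕ, (if (n : ℕ∞) < t then 1 else 0) = (t : ℝ≥0∞) := by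
  induction t using ENat.recTopCoe with
  | top => simp
  | coe N =>
    rw [tsum_eq_sum (s := Finset.range N) (fun n hn => by simpa using hn)]
    rw [Finset.sum_congr rfl fun n hn => if_pos (by simpa using hn)]
    simp

/-- Adding `t` to the square avoids subtraction in `ℝ≥0∞`, so the identity also holds at `⊤`. -/
theorem tsum_succ_mul_indicator_lt (t : ℕ∞) :
    2 * ∑' n : ℕ, ((n : ℝ≥0∞) + 1) * (if (n : ℕ∞) < t then 1 else 0) =
      (t : ℝ≥0∞) ^ 2 + t := by
  induction t using ENat.recTopCoe with
  | top =>
    have h : ∑' n : ℕ, ((n : ℝ≥0∞) + 1) = ∞ :=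
      top_unique ((ENNReal.tsum_const_eq_top_of_ne_zero (α := ℕ) one_ne_zero).symm.le.trans
        (ENNReal.tsum_le_tsum fun n => le_add_self))
    simp [h, ENNReal.mul_top]
  | coe N =>
    rw [tsum_eq_sum (s := Finset.range N) (fun n hn => by
      rw [if_neg (by simpa using hn), mul_zero])]
    rw [Finset.sum_congr rfl fun n hn => by rw [if_pos (by simpa using hn), mul_one]]
    have h : 2 * ∑ n ∈ Finset.range N, (n + 1) = N ^ 2 + N := by
      induction N with
      | zero => simp
      | succ N ih => rw [Finset.sum_range_succ, mul_add, ih]; ring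
    simp only [ENat.toENNReal_coe]
    exact_mod_cast h

/-- There are n + 1 pairs with sum n. -/
theorem tsum_tsum_add (a : ℕ → ℝ≥0∞) :
    ∑' (n : ℕ) (k : ℕ), a (n + k) = ∑' n : ℕ, ((n : ℝ≥0∞) + 1) * a n := by
  rw [← ENNReal.tsum_prod (f := fun n k => a (n + k)),
    ← Equiv.tsum_eq Finset.HasAntidiagonal.sigmaAntidiagonalEquivProd, ENNReal.tsum_sigma']
  refine tsum_congr fun n => ?_
  have h : ∀ p : Finset.HasAntidiagonal.antidiagonal n,
      a ((Finset.HasAntidiagonal.sigmaAntidiagonalEquivProd ⟨n, p⟩).1 +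
        (Finset.HasAntidiagonal.sigmaAntidiagonalEquivProd ⟨n, p⟩).2) = a n := by
    rintro ⟨p, hp⟩
    rw [Finset.HasAntidiagonal.mem_antidiagonal] at hp
    simp [hp]
  rw [tsum_congr h, tsum_fintype]
  simp

end PassageTime

/-! ### Measurability of the passage time. -/

section Measurability

theorem IsMarkovChain.measurableSet_lt_passageTime {S Ω : Type*} [MeasurableSpace Ω]
    {P : Matrix S S ℝ} {μ : Measure Ω} {X : ℕ → Ω → S} (hX : IsMarkovChain P μ X)
    (j : S) (n : ℕ) : MeasurableSet {ω | (n : ℕ∞) < passageTime X j ω} := by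
  simp only [lt_passageTime_iff, Set.ofPred_forall]
  exact MeasurableSet.iInter fun m => MeasurableSet.iInter fun _ =>
    MeasurableSet.iInter fun _ => (hX.measurableSet_eq m j).compl

theorem IsMarkovChain.measurable_indicator_lt {S Ω : Type*} [MeasurableSpace Ω]
    {P : Matrix S S ℝ} {μ : Measure Ω} {X : ℕ → Ω → S} (hX : IsMarkovChain P μ X)
    (j : S) (n : ℕ) :
    Measurable fun ω => if (n : ℕ∞) < passageTime X j ω then (1 : ℝ≥0∞) else 0 :=
  Measurable.ite (hX.measurableSet_lt_passageTime j n) measurable_const measurable_const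

theorem IsMarkovChain.measurable_passageTime {S Ω : Type*} [MeasurableSpace Ω]
    {P : Matrix S S ℝ} {μ : Measure Ω} {X : ℕ → Ω → S} (hX : IsMarkovChain P μ X) (j : S) :
    Measurable fun ω => ((passageTime X j ω : ℕ∞) : ℝ≥0∞) := by
  simp only [← tsum_indicator_lt]
  exact Measurable.tsum fun n => hX.measurable_indicator_lt j n

end Measurability

/-! ### Law and moments of the passage time. -/

section Chain

variable {S Ω : Type*} [Fintype S] [MeasurableSpace Ω]

theorem measure_preimage_inter_eq_sum {α : Type*} [Fintype α] (μ : Measure Ω) {Y : Ω → α}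
    (hY : ∀ a, MeasurableSet {ω | Y ω = a}) {B : Set Ω} (hB : MeasurableSet B)
    (A : α → Prop) [DecidablePred A] :
    μ {ω | A (Y ω) ∧ ω ∈ B} = ∑ a with A a, μ {ω | Y ω = a ∧ ω ∈ B} := by
  have h : {ω | A (Y ω) ∧ ω ∈ B} = ⋃ a ∈ Finset.univ.filter A, {ω | Y ω = a ∧ ω ∈ B} := by
    ext ω; simp
  rw [h, measure_biUnion_finset]
  · intro a _ b _ hab
    rw [Function.onFun, Set.disjoint_left]
    rintro ω ⟨h1, -⟩ ⟨h2, -⟩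
    exact hab (h1.symm.trans h2)
  · intro a _
    exact (hY a).inter hB

theorem measure_eq_sum {α : Type*} [Fintype α] (μ : Measure Ω) {Y : Ω → α}
    (hY : ∀ a, MeasurableSet {ω | Y ω = a}) {B : Set Ω} (hB : MeasurableSet B) :
    μ B = ∑ a, μ {ω | Y ω = a ∧ ω ∈ B} := by
  simpa using measure_preimage_inter_eq_sum μ hY hB fun _ => True

variable {P : Matrix S S ℝ} {μ : Measure Ω} {X : ℕ → Ω → S}

/-- The Markov property, given that the history lies in an arbitrary set. -/
theorem IsMarkovChain.measure_history_and_step (hX : IsMarkovChain P μ X) (n : ℕ)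
    (A : (Fin (n + 1) → S) → Prop) (l k : S) :
    μ {ω | (A (fun m => X m ω) ∧ X n ω = l) ∧ X (n + 1) ω = k} =
      μ {ω | A (fun m => X m ω) ∧ X n ω = l} * ENNReal.ofReal (P l k) := by
  classical
  have hY : ∀ x : Fin (n + 1) → S, MeasurableSet {ω | (fun m : Fin (n + 1) => X m ω) = x} := by
    intro x
    have : {ω | (fun m : Fin (n + 1) => X m ω) = x} = ⋂ m : Fin (n + 1), {ω | X m ω = x m} := by
      ext ω; simp [funext_iff]
    rw [this]
    exact MeasurableSet.iInter fun m => hX.measurableSet_eq m (x m)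
  have h1 := measure_preimage_inter_eq_sum μ hY (hX.measurableSet_eq (n + 1) k)
    (fun x => A x ∧ x (Fin.last n) = l)
  have h2 := measure_preimage_inter_eq_sum μ hY MeasurableSet.univ
    (fun x => A x ∧ x (Fin.last n) = l)
  simp only [Fin.val_last, Set.mem_ofPred_eq, Set.mem_univ, and_true] at h1 h2
  rw [h1, h2, Finset.sum_mul]
  refine Finset.sum_congr rfl fun x hx => ?_
  have hxl : x (Fin.last n) = l := (Finset.mem_filter.1 hx).2.2
  -- The finite history is extended by `k`; only its value at time n + 1 is used.
  have hs := hX.step n (fun m => if h : m < n + 1 then x ⟨m, h⟩ else k)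
  have e1 : {ω | ∀ m ≤ n + 1, X m ω = if h : m < n + 1 then x ⟨m, h⟩ else k} =
      {ω | (fun m : Fin (n + 1) => X m ω) = x ∧ X (n + 1) ω = k} := by
    ext ω
    simp only [Set.mem_ofPred_eq, funext_iff]
    constructor
    · intro h
      refine ⟨fun m => ?_, by simpa using h (n + 1) le_rfl⟩
      simpa [m.2] using h m m.2.le
    · rintro ⟨h, hk⟩ m hm
      split_ifs with hlt
      · exact h ⟨m, hlt⟩
      · obtain rfl : m = n + 1 := by omega
        exact hk
  have e2 : {ω | ∀ m ≤ n, X m ω = if h : m < n + 1 then x ⟨m, h⟩ else k} =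
      {ω | (fun m : Fin (n + 1) => X m ω) = x} := by
    ext ω
    simp only [Set.mem_ofPred_eq, funext_iff]
    constructor
    · intro h m
      simpa [m.2] using h m (Nat.lt_succ_iff.1 m.2)
    · intro h m hm
      rw [dif_pos (Nat.lt_succ_iff.2 hm)]
      exact h ⟨m, _⟩
  rw [e1, e2] at hs
  rw [hs, ← hxl]
  simp [Fin.last]

variable [DecidableEq S]

/-- Induction on n, splitting over the state at time n; the zero column encodes the ban on entering
`j`. Time 0 is exempt, so a start at `j` is allowed and return times are covered. -/
theorem measure_survival_and_eq (hP : P ∈ Matrix.rowStochastic ℝ S) [IsProbabilityMeasure μ]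
    (hX : IsMarkovChain P μ X) {i : S} (h0 : ∀ᵐ ω ∂μ, X 0 ω = i) (j : S) (n : ℕ) (k : S) :
    μ {ω | (∀ m, 1 ≤ m → m ≤ n → X m ω ≠ j) ∧ X n ω = k} =
      ENNReal.ofReal ((taboo P j ^ n) i k) := by
  induction n generalizing k with
  | zero =>
    have h : {ω | (∀ m, 1 ≤ m → m ≤ 0 → X m ω ≠ j) ∧ X 0 ω = k} = {ω | X 0 ω = k} := by
      ext ω
      simp only [Set.mem_ofPred_eq, and_iff_right_iff_imp]
      intro _ m h1 h2
      omega
    rw [h, pow_zero, Matrix.one_apply]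
    split_ifs with hik
    · subst hik
      rw [ENNReal.ofReal_one, ← measure_univ (μ := μ)]
      exact measure_eq_measure_of_null_sdiff (Set.subset_univ _) (by
        rw [← Set.compl_eq_univ_sdiff]; exact h0)
    · rw [ENNReal.ofReal_zero, measure_eq_zero_iff_ae_notMem]
      filter_upwards [h0] with ω hω hk
      exact hik (hω.symm.trans hk)
  | succ n ih =>
    have hstep : ∀ l, μ {ω | X n ω = l ∧ ((∀ m, 1 ≤ m → m ≤ n → X m ω ≠ j) ∧ X (n + 1) ω = k)} =
        ENNReal.ofReal ((taboo P j ^ n) i l) * ENNReal.ofReal (P l k) := by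
      intro l
      have h := hX.measure_history_and_step n
        (fun x => ∀ m : Fin (n + 1), 1 ≤ (m : ℕ) → x m ≠ j) l k
      have e : ∀ ω, (∀ m : Fin (n + 1), 1 ≤ (m : ℕ) → X m ω ≠ j) ↔
          ∀ m, 1 ≤ m → m ≤ n → X m ω ≠ j := fun ω =>
        ⟨fun h m h1 hm => h ⟨m, Nat.lt_succ_iff.2 hm⟩ h1,
          fun h m h1 => h m h1 (Nat.lt_succ_iff.1 m.2)⟩
      simp only [e, ih l] at h
      rw [← h]
      congr 1
      ext ω
      simp only [Set.mem_ofPred_eq]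
      tauto
    rw [pow_succ, Matrix.mul_apply]
    by_cases hk : k = j
    · have : {ω | (∀ m, 1 ≤ m → m ≤ n + 1 → X m ω ≠ j) ∧ X (n + 1) ω = k} = ∅ := by
        ext ω
        simp only [Set.mem_ofPred_eq, Set.mem_empty_iff_false, iff_false, not_and]
        intro h h'
        exact h (n + 1) (by omega) le_rfl (h'.trans hk)
      rw [this]
      simp [taboo_apply, hk]
    · have hset : {ω | (∀ m, 1 ≤ m → m ≤ n + 1 → X m ω ≠ j) ∧ X (n + 1) ω = k} =
          {ω | (∀ m, 1 ≤ m → m ≤ n → X m ω ≠ j) ∧ X (n + 1) ω = k} := by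
        ext ω
        simp only [Set.mem_ofPred_eq]
        constructor
        · rintro ⟨h, h'⟩
          exact ⟨fun m h1 hm => h m h1 (by omega), h'⟩
        · rintro ⟨h, h'⟩
          refine ⟨fun m h1 hm => ?_, h'⟩
          rcases Nat.lt_or_ge n m with hlt | hle
          · obtain rfl : m = n + 1 := by omega
            exact h' ▸ hk
          · exact h m h1 hle
      have hmeas : MeasurableSet {ω | (∀ m, 1 ≤ m → m ≤ n → X m ω ≠ j) ∧ X (n + 1) ω = k} := by
        refine MeasurableSet.inter ?_ (hX.measurableSet_eq (n + 1) k)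
        have h := hX.measurableSet_lt_passageTime j n
        simp only [lt_passageTime_iff] at h
        exact h
      rw [hset, measure_eq_sum μ (hX.measurableSet_eq n) hmeas,
        ENNReal.ofReal_sum_of_nonneg fun l _ => mul_nonneg
          (Matrix.pow_apply_nonneg (taboo_nonneg hP j) n i l) (taboo_nonneg hP j l k)]
      refine Finset.sum_congr rfl fun l _ => ?_
      rw [taboo_apply, if_neg hk,
        ENNReal.ofReal_mul (Matrix.pow_apply_nonneg (taboo_nonneg hP j) n i l), ← hstep l]
      rfl

/-- The tail of the first passage time. -/
theorem measure_lt_passageTime (hP : P ∈ Matrix.rowStochastic ℝ S) [IsProbabilityMeasure μ]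
    (hX : IsMarkovChain P μ X) {i : S} (h0 : ∀ᵐ ω ∂μ, X 0 ω = i) (j : S) (n : ℕ) :
    μ {ω | (n : ℕ∞) < passageTime X j ω} = ENNReal.ofReal ((taboo P j ^ n *ᵥ 1) i) := by
  rw [measure_eq_sum μ (hX.measurableSet_eq n) (hX.measurableSet_lt_passageTime j n)]
  simp only [Matrix.mulVec, dotProduct_one]
  rw [ENNReal.ofReal_sum_of_nonneg fun l _ => Matrix.pow_apply_nonneg (taboo_nonneg hP j) n i l]
  refine Finset.sum_congr rfl fun l _ => ?_
  rw [← measure_survival_and_eq hP hX h0]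
  simp only [Set.mem_ofPred_eq, lt_passageTime_iff]
  congr 1
  ext ω
  exact and_comm

theorem lintegral_indicator_lt (hP : P ∈ Matrix.rowStochastic ℝ S) [IsProbabilityMeasure μ]
    (hX : IsMarkovChain P μ X) {i : S} (h0 : ∀ᵐ ω ∂μ, X 0 ω = i) (j : S) (n : ℕ) :
    ∫⁻ ω, (if (n : ℕ∞) < passageTime X j ω then (1 : ℝ≥0∞) else 0) ∂μ =
      ENNReal.ofReal ((taboo P j ^ n *ᵥ 1) i) := by
  rw [← measure_lt_passageTime hP hX h0, ← lintegral_indicator_one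
    (hX.measurableSet_lt_passageTime j n)]
  simp [Set.indicator_apply]

theorem tsum_ofReal_taboo_pow_add (hP : P ∈ Matrix.rowStochastic ℝ S) (hirr : P.IsIrreducible)
    (j : S) {v : S → ℝ} (hv : 0 ≤ v) (n : ℕ) (i : S) :
    ∑' k : ℕ, ENNReal.ofReal ((taboo P j ^ (n + k) *ᵥ v) i) =
      ENNReal.ofReal ((taboo P j ^ n *ᵥ potential P j v) i) := by
  have h := Pi.hasSum.1 (hasSum_taboo_pow_add_mulVec hP hirr j hv n) i
  rw [← h.tsum_eq, ENNReal.ofReal_tsum_of_nonneg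
    (fun k => taboo_pow_mulVec_nonneg hP j hv (n + k) i) h.summable]

theorem tsum_ofReal_taboo_pow (hP : P ∈ Matrix.rowStochastic ℝ S) (hirr : P.IsIrreducible)
    (j : S) {v : S → ℝ} (hv : 0 ≤ v) (i : S) :
    ∑' k : ℕ, ENNReal.ofReal ((taboo P j ^ k *ᵥ v) i) = ENNReal.ofReal (potential P j v i) := by
  simpa using tsum_ofReal_taboo_pow_add hP hirr j hv 0 i

variable {ℙ : S → Measure Ω}

theorem passageMoment_one (hP : P ∈ Matrix.rowStochastic ℝ S) (hirr : P.IsIrreducible)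
    (hprob : ∀ i, IsProbabilityMeasure (ℙ i)) (hX : ∀ i, IsMarkovChain P (ℙ i) X)
    (hX0 : ∀ i, ∀ᵐ ω ∂(ℙ i), X 0 ω = i) (i j : S) :
    passageMoment ℙ X 1 i j = ENNReal.ofReal (potential P j 1 i) := by
  have := hprob i
  simp only [passageMoment, pow_one, ← tsum_indicator_lt]
  rw [lintegral_tsum fun n => ((hX i).measurable_indicator_lt j n).aemeasurable,
    ← tsum_ofReal_taboo_pow hP hirr j zero_le_one]
  exact tsum_congr fun n => lintegral_indicator_lt hP (hX i) (hX0 i) j n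

/-- The weights n + 1 in the tail sum are those of the double series ∑ₙ Qⁿ ∑ₖ Qᵏe, an iterated
potential. -/
theorem passageMoment_two_add (hP : P ∈ Matrix.rowStochastic ℝ S) (hirr : P.IsIrreducible)
    (hprob : ∀ i, IsProbabilityMeasure (ℙ i)) (hX : ∀ i, IsMarkovChain P (ℙ i) X)
    (hX0 : ∀ i, ∀ᵐ ω ∂(ℙ i), X 0 ω = i) (i j : S) :
    passageMoment ℙ X 2 i j + passageMoment ℙ X 1 i j =
      2 * ENNReal.ofReal (potential P j (potential P j 1) i) := by
  have := hprob i
  rw [passageMoment, passageMoment,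
    ← lintegral_add_left (((hX i).measurable_passageTime j).pow_const 2)]
  simp only [pow_one, ← tsum_succ_mul_indicator_lt]
  have hmeas : ∀ n : ℕ, Measurable fun ω => ((n : ℝ≥0∞) + 1) *
      (if (n : ℕ∞) < passageTime X j ω then (1 : ℝ≥0∞) else 0) := fun n =>
    ((hX i).measurable_indicator_lt j n).const_mul _
  rw [lintegral_const_mul _ (Measurable.tsum hmeas),
    lintegral_tsum fun n => (hmeas n).aemeasurable,
    ← tsum_ofReal_taboo_pow hP hirr j (potential_nonneg hP j zero_le_one)]
  simp only [← tsum_ofReal_taboo_pow_add hP hirr j zero_le_one]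
  rw [tsum_tsum_add fun n => ENNReal.ofReal ((taboo P j ^ n *ᵥ 1) i)]
  congr 1
  refine tsum_congr fun n => ?_
  rw [lintegral_const_mul _ ((hX i).measurable_indicator_lt j n),
    lintegral_indicator_lt hP (hX i) (hX0 i)]

theorem passageMoment_two_ne_top (hP : P ∈ Matrix.rowStochastic ℝ S) (hirr : P.IsIrreducible)
    (hprob : ∀ i, IsProbabilityMeasure (ℙ i)) (hX : ∀ i, IsMarkovChain P (ℙ i) X)
    (hX0 : ∀ i, ∀ᵐ ω ∂(ℙ i), X 0 ω = i) (i j : S) : passageMoment ℙ X 2 i j ≠ ∞ := by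
  refine ne_top_of_le_ne_top ?_ (le_self_add (b := passageMoment ℙ X 1 i j))
  rw [passageMoment_two_add hP hirr hprob hX hX0]
  exact ENNReal.mul_ne_top ENNReal.ofNat_ne_top ENNReal.ofReal_ne_top

theorem momentMatrix_one_apply (hP : P ∈ Matrix.rowStochastic ℝ S) (hirr : P.IsIrreducible)
    (hprob : ∀ i, IsProbabilityMeasure (ℙ i)) (hX : ∀ i, IsMarkovChain P (ℙ i) X)
    (hX0 : ∀ i, ∀ᵐ ω ∂(ℙ i), X 0 ω = i) (i j : S) :
    momentMatrix ℙ X 1 i j = potential P j 1 i := by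
  rw [momentMatrix, Matrix.of_apply, passageMoment_one hP hirr hprob hX hX0,
    ENNReal.toReal_ofReal (potential_nonneg hP j zero_le_one i)]

theorem momentMatrix_two_apply (hP : P ∈ Matrix.rowStochastic ℝ S) (hirr : P.IsIrreducible)
    (hprob : ∀ i, IsProbabilityMeasure (ℙ i)) (hX : ∀ i, IsMarkovChain P (ℙ i) X)
    (hX0 : ∀ i, ∀ᵐ ω ∂(ℙ i), X 0 ω = i) (i j : S) :
    momentMatrix ℙ X 2 i j =
      2 * potential P j (potential P j 1) i - potential P j 1 i := by
  have h := congrArg ENNReal.toReal (passageMoment_two_add hP hirr hprob hX hX0 i j)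
  rw [ENNReal.toReal_add (passageMoment_two_ne_top hP hirr hprob hX hX0 i j)
    (by rw [passageMoment_one hP hirr hprob hX hX0]; exact ENNReal.ofReal_ne_top),
    ENNReal.toReal_mul, ENNReal.toReal_ofReal
      (potential_nonneg hP j (potential_nonneg hP j zero_le_one) i)] at h
  have h1 := momentMatrix_one_apply hP hirr hprob hX hX0 i j
  simp only [momentMatrix, Matrix.of_apply, ENNReal.toReal_ofNat] at h h1 ⊢
  linarith

end Chain

/-! ### Generalized inverses and the fundamental matrix. -/

section GroupInverse

theorem rowMatrix_mul_self {S : Type*} [Fintype S] {P : Matrix S S ℝ} {π : S → ℝ}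
    (hπ : IsStationary P π) :
    rowMatrix π * rowMatrix π = rowMatrix π := by
  rw [rowMatrix, Matrix.vecMulVec_mul_vecMulVec, stationary_dotProduct_one hπ]
  simp

variable {S : Type*} [Fintype S] [DecidableEq S] {P : Matrix S S ℝ} {π : S → ℝ}

theorem one_sub_mul_rowMatrix (hP : P ∈ Matrix.rowStochastic ℝ S) :
    (1 - P) * rowMatrix π = 0 := by
  rw [rowMatrix, Matrix.mul_vecMulVec, Matrix.sub_mulVec, one_vecMul_of_mem_rowStochastic hP,
    Matrix.one_mulVec, sub_self, Matrix.zero_vecMulVec]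

theorem rowMatrix_mul_one_sub (hπ : IsStationary P π) : rowMatrix π * (1 - P) = 0 := by
  rw [rowMatrix, Matrix.vecMulVec_mul, Matrix.vecMul_sub, hπ.2, Matrix.vecMul_one, sub_self,
    Matrix.vecMulVec_zero]

theorem one_sub_rowMatrix_mulVec_one (hπ : IsStationary P π) :
    (1 - rowMatrix π) *ᵥ 1 = 0 := by
  rw [Matrix.sub_mulVec, rowMatrix, Matrix.vecMulVec_mulVec, stationary_dotProduct_one hπ]
  simp

theorem vecMul_one_sub_rowMatrix (hπ : IsStationary P π) : π ᵥ* (1 - rowMatrix π) = 0 := by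
  rw [Matrix.vecMul_sub, rowMatrix, Matrix.vecMul_vecMulVec, stationary_dotProduct_one hπ]
  simp

/-- Both products of I-P with Π vanish, so I-P absorbs the projections. -/
theorem isGInverse_project (hP : P ∈ Matrix.rowStochastic ℝ S) (hπ : IsStationary P π)
    {G : Matrix S S ℝ} (hG : IsGInverse (1 - P) G) :
    IsGInverse (1 - P) ((1 - rowMatrix π) * G * (1 - rowMatrix π)) := by
  have h1 : (1 - P) * (1 - rowMatrix π) = 1 - P := by
    rw [mul_sub, one_sub_mul_rowMatrix hP, mul_one, sub_zero]
  have h2 : (1 - rowMatrix π) * (1 - P) = 1 - P := by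
    rw [sub_mul, rowMatrix_mul_one_sub hπ, one_mul, sub_zero]
  calc (1 - P) * ((1 - rowMatrix π) * G * (1 - rowMatrix π)) * (1 - P)
      = ((1 - P) * (1 - rowMatrix π)) * G * ((1 - rowMatrix π) * (1 - P)) := by
        simp only [mul_assoc]
    _ = 1 - P := by rw [h1, h2]; exact hG

/-- Here GΠ = gΠ, which I-Π annihilates. -/
theorem project_eq_of_mulVec_one {G : Matrix S S ℝ} (hπ : IsStationary P π) {g : ℝ}
    (hg : G *ᵥ 1 = g • (1 : S → ℝ)) :
    (1 - rowMatrix π) * G * (1 - rowMatrix π) = (1 - rowMatrix π) * G := by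
  have h : (1 - rowMatrix π) * G * rowMatrix π = 0 := by
    rw [mul_assoc]
    nth_rewrite 2 [rowMatrix]
    rw [Matrix.mul_vecMulVec, hg, Matrix.mul_vecMulVec, Matrix.mulVec_smul,
      one_sub_rowMatrix_mulVec_one hπ, smul_zero, Matrix.zero_vecMulVec]
  rw [mul_sub, h, mul_one, sub_zero]

/-- Commutation turns A = A(I-P)A into (I-P)AA and AA(I-P), so ΠA = AΠ = 0. -/
theorem IsGroupInverse.project_eq (hP : P ∈ Matrix.rowStochastic ℝ S) (hπ : IsStationary P π)
    {A : Matrix S S ℝ} (hA : IsGroupInverse (1 - P) A) :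
    (1 - rowMatrix π) * A * (1 - rowMatrix π) = A := by
  obtain ⟨-, h2, h3⟩ := hA
  have hl : rowMatrix π * A = 0 := by
    rw [← h2, ← h3, ← mul_assoc, ← mul_assoc, rowMatrix_mul_one_sub hπ, zero_mul, zero_mul]
  have hr : A * rowMatrix π = 0 := by
    rw [← h2, mul_assoc A, h3, mul_assoc, mul_assoc, one_sub_mul_rowMatrix hP, mul_zero, mul_zero]
  rw [sub_mul, hl, one_mul, sub_zero, mul_sub, hr, mul_one, sub_zero]

/-- Applying Π to the kernel equation gives Πv = 0; then v is harmonic, hence constant, with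
π-average zero. -/
theorem isUnit_one_sub_add_rowMatrix (hP : P ∈ Matrix.rowStochastic ℝ S)
    (hirr : P.IsIrreducible) (hπ : IsStationary P π) : IsUnit (1 - P + rowMatrix π) := by
  rw [← Matrix.mulVec_injective_iff_isUnit, ← Matrix.coe_mulVecLin, ← LinearMap.ker_eq_bot,
    LinearMap.ker_eq_bot']
  intro v hv
  rw [Matrix.mulVecLin_apply] at hv
  have h1 : rowMatrix π *ᵥ v = 0 := by
    have h := congrArg (rowMatrix π *ᵥ ·) hv
    simpa [Matrix.mulVec_mulVec, mul_add, rowMatrix_mul_one_sub hπ, rowMatrix_mul_self hπ] using h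
  rw [Matrix.add_mulVec, h1, add_zero, Matrix.sub_mulVec, Matrix.one_mulVec, sub_eq_zero] at hv
  ext j
  have h2 := eq_const_of_mulVec_eq hP hirr j hv.symm
  rw [h2, Matrix.mulVec_smul, rowMatrix, Matrix.vecMulVec_mulVec,
    stationary_dotProduct_one hπ] at h1
  simpa using congrFun h1 j

/-- From ZΠ = ΠZ = Π, both products of I-P with Z-Π equal I-Π. -/
theorem isGroupInverse_fundamental (hP : P ∈ Matrix.rowStochastic ℝ S)
    (hirr : P.IsIrreducible) (hπ : IsStationary P π) :
    IsGroupInverse (1 - P) ((1 - P + rowMatrix π)⁻¹ - rowMatrix π) := by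
  have hdet := (Matrix.isUnit_iff_isUnit_det _).1 (isUnit_one_sub_add_rowMatrix hP hirr hπ)
  have hl := Matrix.nonsing_inv_mul _ hdet
  have hr := Matrix.mul_nonsing_inv _ hdet
  set Z := (1 - P + rowMatrix π)⁻¹
  have hZr : Z * rowMatrix π = rowMatrix π := by
    have h : (1 - P + rowMatrix π) * rowMatrix π = rowMatrix π := by
      rw [add_mul, one_sub_mul_rowMatrix hP, rowMatrix_mul_self hπ, zero_add]
    nth_rewrite 1 [← h]
    rw [← mul_assoc, hl, one_mul]
  have hZl : rowMatrix π * Z = rowMatrix π := by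
    have h : rowMatrix π * (1 - P + rowMatrix π) = rowMatrix π := by
      rw [mul_add, rowMatrix_mul_one_sub hπ, rowMatrix_mul_self hπ, zero_add]
    nth_rewrite 1 [← h]
    rw [mul_assoc, hr, mul_one]
  have h1 : (1 - P) * (Z - rowMatrix π) = 1 - rowMatrix π := by
    rw [mul_sub, one_sub_mul_rowMatrix hP, sub_zero, eq_sub_iff_add_eq]
    rwa [add_mul, hZl] at hr
  have h2 : (Z - rowMatrix π) * (1 - P) = 1 - rowMatrix π := by
    rw [sub_mul, rowMatrix_mul_one_sub hπ, sub_zero, eq_sub_iff_add_eq]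
    rwa [mul_add, hZr] at hl
  refine ⟨?_, ?_, h1.trans h2.symm⟩
  · rw [h1, sub_mul, rowMatrix_mul_one_sub hπ, one_mul, sub_zero]
  · rw [h2, sub_mul, one_mul, mul_sub, hZl, rowMatrix_mul_self hπ, sub_self, sub_zero]

end GroupInverse

end FirstPassage

open FirstPassage
theorem corollary7p7p2 {S Ω : Type*} [Fintype S] [DecidableEq S] [MeasurableSpace Ω]
    (P : Matrix S S ℝ) (hP : P ∈ Matrix.rowStochastic ℝ S) (hirr : P.IsIrreducible)
    (π : S → ℝ) (hπ : IsStationary P π)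
    (ℙ : S → Measure Ω) (hprob : ∀ i, IsProbabilityMeasure (ℙ i))
    (X : ℕ → Ω → S) (hX : ∀ i, IsMarkovChain P (ℙ i) X) (hX0 : ∀ i, ∀ᵐ ω ∂(ℙ i), X 0 ω = i) :
    -- the quantities in the formulas are well defined
    (∀ i, 0 < π i) ∧
    (∀ i j, passageMoment ℙ X 2 i j ≠ ∞) ∧
    diagPart (momentMatrix ℙ X 1) = recipDiag π ∧
    -- an arbitrary generalized inverse
    (∀ G : Matrix S S ℝ, IsGInverse (1 - P) G →
      diagPart (momentMatrix ℙ X 2) =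
        recipDiag π + (2 : ℝ) • (recipDiag π *
          diagPart ((1 - rowMatrix π) * G * (1 - rowMatrix π)) * recipDiag π)) ∧
    -- a generalized inverse with constant row sums
    (∀ (G : Matrix S S ℝ) (g : ℝ), IsGInverse (1 - P) G → G *ᵥ 1 = g • (1 : S → ℝ) →
      diagPart (momentMatrix ℙ X 2) =
        recipDiag π + (2 : ℝ) • (recipDiag π *
          diagPart ((1 - rowMatrix π) * G) * recipDiag π)) ∧
    -- the group inverse
    IsUnit (1 - P + rowMatrix π) ∧
    IsGroupInverse (1 - P) ((1 - P + rowMatrix π)⁻¹ - rowMatrix π) ∧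
    (∀ A : Matrix S S ℝ, IsGroupInverse (1 - P) A →
      diagPart (momentMatrix ℙ X 2) =
        recipDiag π + (2 : ℝ) • (recipDiag π * diagPart A * recipDiag π)) ∧
    -- the fundamental matrix
    diagPart (momentMatrix ℙ X 2) =
      (2 : ℝ) • (recipDiag π * diagPart (1 - P + rowMatrix π)⁻¹ * recipDiag π) -
        recipDiag π := by
  have hm : ∀ j, potential P j 1 = 1 + taboo P j *ᵥ potential P j 1 := fun j =>
    potential_eq hP hirr j zero_le_one
  have hw : ∀ j, potential P j (potential P j 1) =
      potential P j 1 + taboo P j *ᵥ potential P j (potential P j 1) := fun j =>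
    potential_eq hP hirr j (potential_nonneg hP j zero_le_one)
  have hkac : ∀ j, π j * potential P j 1 j = 1 := fun j => stationary_mul_eq_one hπ j (hm j)
  have hginv : ∀ G : Matrix S S ℝ, IsGInverse (1 - P) G →
      diagPart (momentMatrix ℙ X 2) =
        recipDiag π + (2 : ℝ) • (recipDiag π *
          diagPart ((1 - rowMatrix π) * G * (1 - rowMatrix π)) * recipDiag π) := by
    intro G hG
    simp only [diagPart, recipDiag, Matrix.diagonal_mul_diagonal, Matrix.diagonal_add,
      ← Matrix.diagonal_smul]
    refine congrArg Matrix.diagonal (funext fun j => ?_)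
    simp only [Matrix.diag_apply, Pi.smul_apply, smul_eq_mul]
    rw [momentMatrix_two_apply hP hirr hprob hX hX0]
    refine two_mul_sub_eq hP hirr hπ j (hm j) (hw j) (isGInverse_project hP hπ hG) ?_ ?_
    · rw [← Matrix.mulVec_mulVec, one_sub_rowMatrix_mulVec_one hπ, Matrix.mulVec_zero]
    · rw [mul_assoc, ← Matrix.vecMul_vecMul, vecMul_one_sub_rowMatrix hπ, Matrix.zero_vecMul]
  have hgroup : ∀ A : Matrix S S ℝ, IsGroupInverse (1 - P) A →
      diagPart (momentMatrix ℙ X 2) =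
        recipDiag π + (2 : ℝ) • (recipDiag π * diagPart A * recipDiag π) := by
    intro A hA
    rw [hginv A hA.1, hA.project_eq hP hπ]
  have hpos : ∀ i, 0 < π i := fun i =>
    (hπ.1.1 i).lt_of_ne' (left_ne_zero_of_mul_eq_one (hkac i))
  have hfund := isGroupInverse_fundamental hP hirr hπ
  refine ⟨hpos, passageMoment_two_ne_top hP hirr hprob hX hX0, ?_, hginv, ?_,
    isUnit_one_sub_add_rowMatrix hP hirr hπ, hfund, hgroup, ?_⟩
  · refine congrArg Matrix.diagonal (funext fun j => ?_)
    rw [Matrix.diag_apply, momentMatrix_one_apply hP hirr hprob hX hX0, eq_div_iff (hpos j).ne',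
      mul_comm, hkac j]
  · intro G g hG hg
    rw [hginv G hG, project_eq_of_mulVec_one hπ hg]
  -- The diagonal of Π is π, so subtracting Π from Z costs 2D and turns +D into -D.
  · rw [hgroup _ hfund]
    simp only [diagPart, recipDiag, Matrix.diagonal_mul_diagonal, Matrix.diagonal_add,
      ← Matrix.diagonal_smul, Matrix.diagonal_sub]
    refine congrArg Matrix.diagonal (funext fun j => ?_)
    have hj := (hpos j).ne'
    simp only [Matrix.diag_apply, Matrix.sub_apply, Pi.smul_apply, smul_eq_mul, rowMatrix,
      Matrix.vecMulVec_apply, Pi.one_apply, one_mul]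
    field_simp
    ring
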